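/- For positive integers $n,k$ with $n\ge 2k+1$, the Kneser graph $\mathrm{KG}(n,k)$ is the graph whose vertices are the $k$-element subsets of $\{1,\dots,n\}$, two of them being adjacent if and only if they are disjoint. An axis-parallel box in $\mathbb{R}^d$ is a Cartesian product $I_1\times\cdots\times I_d$ of nonempty closed bounded intervals of the real line (possibly single points; for $d=0$ the box is a single point). The boxicity of a finite simple graph $G$ is the minimum integer $d\ge 0$ such that $G$ is the intersection graph of a family of axis-parallel boxes in $\mathbb{R}^d$, i.e. such that one can assign to every vertex $v$ a box $B_v\subseteq\mathbb{R}^d$ (not necessarily distinct for distinct vertices) so that any two distinct vertices $u,v$ are adjacent if and only if $B_u\cap B_v\neq\emptyset$. Theorem. For every integer $n\ge 5$, the boxicity of the Kneser graph $\mathrm{KG}(n,2)$ is exactly $n-2$. In particular, the boxicity of the Petersen graph $\mathrm{KG}(5,2)$ is $3$. -/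

import Mathlib

/-- The Kneser graph `KG(n, k)`: the vertices are the `k`-element subsets of an `n`-element set,
and two distinct vertices are adjacent if and only if they are disjoint.  (Distinctness follows
from disjointness unless `k = 0`.) -/
def kneserGraph (n k : ℕ) : SimpleGraph {s : Finset (Fin n) // s.card = k} where
  Adj s t := s ≠ t ∧ Disjoint s.1 t.1
  symm := ⟨fun _ _ h => ⟨h.1.symm, h.2.symm⟩⟩
  loopless := ⟨fun _ h => h.1 rfl⟩

/-- A set `B ⊆ ℝ^d` is an axis-parallel box if it is a Cartesian product of `d` (nonempty,
possibly degenerate) closed intervals of the real line.  For `d = 0` the only box is the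
one-point space. -/
def IsAxisParallelBox {d : ℕ} (B : Set (Fin d → ℝ)) : Prop :=
  ∃ a b : Fin d → ℝ, (∀ i, a i ≤ b i) ∧ B = Set.univ.pi fun i => Set.Icc (a i) (b i)

/-- The intersection graph of an indexed family of sets (repetitions allowed): two different
indices are adjacent if and only if the corresponding sets intersect. -/
def intersectionGraph {V X : Type*} (F : V → Set X) : SimpleGraph V where
  Adj u v := u ≠ v ∧ (F u ∩ F v).Nonempty
  symm := ⟨fun u v h => ⟨h.1.symm, Set.inter_comm (F u) (F v) ▸ h.2⟩⟩
  loopless := ⟨fun _ h => h.1 rfl⟩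

/-- `G` is the intersection graph of a family of axis-parallel boxes in `ℝ^d`. -/
def HasBoxRepresentation {V : Type*} (G : SimpleGraph V) (d : ℕ) : Prop :=
  ∃ B : V → Set (Fin d → ℝ), (∀ v, IsAxisParallelBox (B v)) ∧ G = intersectionGraph B

/-- The boxicity of `G`: the minimum dimension `d` such that `G` is the intersection graph of a
family of axis-parallel boxes in `ℝ^d` (and `⊤` if there is no such `d`, which is only possible
for infinite graphs). -/
noncomputable def boxicity {V : Type*} (G : SimpleGraph V) : ℕ∞ :=
  ⨅ d ∈ {d : ℕ | HasBoxRepresentation G d}, (d : ℕ∞)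

/-!
Write an edge `xy` of the complete graph for the vertex `{x, y}` of the Kneser graph. In each
coordinate of a box representation the edges carry intervals `[L x y, R x y]`, and `xy < zw`, meaning
`R x y < L z w`, is an interval order in which comparable edges share exactly one endpoint. Being a
representation means that any two edges `vp`, `vq` are comparable in at least one coordinate. The
boxicity is thus the least number of such interval orders that together compare all pairs of
adjacent edges.

*Upper bound.* Fix two points `0` and `n - 1`, and take one order for each other vertex `a`: the edge
`ax` is the point `x`, all other edges are long intervals, shortened so that `a0 < 0x` and
`x(n-1) < a(n-1)`. A pair `vp`, `vq` is compared in coordinate `v` if `v` is such a centre, and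
otherwise in coordinate `p` or `q` (`exists_kneserHi_lt_kneserLo`).

*Lower bound.* Let `ab` have the smallest right end and `ac` the largest left end; whenever some pair
is comparable, these two are comparable, so they do share an endpoint `a`. Every comparable pair
`e < f` satisfies `ab < f` and `e < ac`, so `e` meets `ac` and `f` meets `ab`. Either all comparable
pairs use an edge at `a`, in which case `a` can be deleted together with this coordinate and
induction on the number of vertices applies (`IsSeparating.erase`); or some pair avoids `a`, and then
the axiom that `e < f` and `g < h` imply `e < h` or `g < f` forces the order to be small
(`IsAnchored.hasSmallPatch`).

Smallness is measured in the links. At a vertex `v`, the pairs `vp`, `vq` compared in one coordinate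
form a graph on the remaining vertices, which is covered by `s` stars and `e` single pairs. As the
link of `v` is complete on `n - 1` vertices, the totals over all coordinates satisfy
`(n - 1 - s).choose 2 ≤ e` (`IsSeparating.choose_two_le`), hence `2 * s + e ≥ 2 * n - 5`. In a small
order the sum of `2 * s + e` over all vertices is at most `13`. If all orders are small, this gives
`n * (2 * n - 5) ≤ 13 * d`, which contradicts `d ≤ n - 3` for `n ≥ 6`. For `n = 5`, where the induction
starts, star-like orders must be counted too, and the weight `2 * s + e` is replaced by the subadditive
`petersenWeight s e`: it totals at least `16` at each of the five vertices and at most `39` in each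
coordinate, and `5 * 16 > 2 * 39`.
-/

/-! ### Interval orders on the edges of a complete graph -/

/-- Intervals `[L x y, R x y]` attached to the edges `xy` of the complete graph on `U`, such that
edges with disjoint intervals share an endpoint. Edges are encoded by symmetric functions of two
variables; the values on the diagonal are irrelevant. -/
structure IsLineOrder {V : Type*} (U : Finset V) (L R : V → V → ℝ) : Prop where
  symmL : ∀ x y, L x y = L y x
  symmR : ∀ x y, R x y = R y x
  le : ∀ x ∈ U, ∀ y ∈ U, x ≠ y → L x y ≤ R x y
  meet : ∀ x ∈ U, ∀ y ∈ U, ∀ z ∈ U, ∀ w ∈ U, x ≠ y → z ≠ w → R x y < L z w →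
    x = z ∨ x = w ∨ y = z ∨ y = w

/-- The interval order has `ab` as an edge of smallest right end and `ac` as an edge of largest left
end. -/
structure IsAnchored {V : Type*} (U : Finset V) (L R : V → V → ℝ) (a b c : V) : Prop
    extends IsLineOrder U L R where
  ha : a ∈ U
  hb : b ∈ U
  hc : c ∈ U
  hab : a ≠ b
  hac : a ≠ c
  hbc : b ≠ c
  first : ∀ x ∈ U, ∀ y ∈ U, x ≠ y → R a b ≤ R x y
  last : ∀ x ∈ U, ∀ y ∈ U, x ≠ y → L x y ≤ L a c

/-- If some pair of edges is comparable, then so are the edge with the smallest right end and the one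
with the largest left end; hence they share an endpoint. -/
theorem IsLineOrder.exists_isAnchored {V : Type*} {U : Finset V} {L R : V → V → ℝ}
    (h : IsLineOrder U L R) {x y z w : V} (hx : x ∈ U) (hy : y ∈ U) (hz : z ∈ U) (hw : w ∈ U)
    (hxy : x ≠ y) (hzw : z ≠ w) (hlt : R x y < L z w) : ∃ a b c, IsAnchored U L R a b c := by
  classical
  have hne : (U.offDiag).Nonempty := ⟨(x, y), by simp [hx, hy, hxy]⟩
  obtain ⟨⟨a, b⟩, hab, hmin⟩ := Finset.exists_min_image U.offDiag (fun p => R p.1 p.2) hne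
  obtain ⟨⟨c, d⟩, hcd, hmax⟩ := Finset.exists_max_image U.offDiag (fun p => L p.1 p.2) hne
  simp only [Finset.mem_offDiag, Prod.forall, and_imp] at hab hcd hmin hmax
  have h1 : R a b < L c d :=
    (hmin x y hx hy hxy).trans_lt (hlt.trans_le (hmax z w hz hw hzw))
  have hle := h.le a hab.1 b hab.2.1 hab.2.2
  have hsL := h.symmL
  have hsR := h.symmR
  obtain ⟨ha, hb, hab⟩ := hab
  obtain ⟨hc, hd, hcd⟩ := hcd
  have key : ∀ a b c : V, a ∈ U → b ∈ U → c ∈ U → a ≠ b → a ≠ c → R a b < L a c →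
      L a b ≤ R a b →
      (∀ x y, x ∈ U → y ∈ U → x ≠ y → R a b ≤ R x y) →
      (∀ x y, x ∈ U → y ∈ U → x ≠ y → L x y ≤ L a c) → ∃ a b c, IsAnchored U L R a b c := by
    intro a b c ha hb hc hab hac h1 h2 h3 h4
    refine ⟨a, b, c, h, ha, hb, hc, hab, hac, ?_, fun x hx y hy => h3 x y hx hy,
      fun x hx y hy => h4 x y hx hy⟩
    rintro rfl
    exact absurd h1 (not_lt.2 h2)
  rcases h.meet a ha b hb c hc d hd hab hcd h1 with rfl | rfl | rfl | rfl
  · exact key a b d ha hb hd hab hcd h1 hle hmin hmax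
  · rw [hsL c a] at h1 hmax
    exact key a b c ha hb hc hab hcd.symm h1 hle hmin hmax
  · rw [hsR a b] at h1 hmin hle
    rw [hsL a b] at hle
    exact key b a d hb ha hd hab.symm hcd h1 hle hmin hmax
  · rw [hsR a b] at h1 hmin hle
    rw [hsL a b] at hle
    rw [hsL c b] at h1 hmax
    exact key b a c hb ha hc hab.symm hcd.symm h1 hle hmin hmax

namespace IsAnchored
variable {V : Type*} {U : Finset V} {L R : V → V → ℝ} {a b c : V}

/-- Reversing the real line exchanges the roles of `b` and `c`. -/
theorem reverse (h : IsAnchored U L R a b c) :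
    IsAnchored U (fun x y => -R x y) (fun x y => -L x y) a c b where
  symmL x y := by simp [h.symmR x y]
  symmR x y := by simp [h.symmL x y]
  le x hx y hy hxy := neg_le_neg (h.le x hx y hy hxy)
  meet x hx y hy z hz w hw hxy hzw hlt := by
    have := h.meet z hz w hw x hx y hy hzw hxy (neg_lt_neg_iff.1 hlt)
    tauto
  ha := h.ha
  hb := h.hc
  hc := h.hb
  hab := h.hac
  hac := h.hab
  hbc := h.hbc.symm
  first x hx y hy hxy := neg_le_neg (h.last x hx y hy hxy)
  last x hx y hy hxy := neg_le_neg (h.first x hx y hy hxy)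

theorem right_mem (h : IsAnchored U L R a b c) {x y z w : V} (hx : x ∈ U) (hy : y ∈ U)
    (hz : z ∈ U) (hw : w ∈ U) (hxy : x ≠ y) (hzw : z ≠ w) (hlt : R x y < L z w) :
    z = a ∨ z = b ∨ w = a ∨ w = b := by
  have := h.meet a h.ha b h.hb z hz w hw h.hab hzw ((h.first x hx y hy hxy).trans_lt hlt)
  tauto

theorem left_mem (h : IsAnchored U L R a b c) {x y z w : V} (hx : x ∈ U) (hy : y ∈ U)
    (hz : z ∈ U) (hw : w ∈ U) (hxy : x ≠ y) (hzw : z ≠ w) (hlt : R x y < L z w) :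
    x = a ∨ x = c ∨ y = a ∨ y = c :=
  h.meet x hx y hy a h.ha c h.hc hxy h.hac (hlt.trans_le (h.last z hz w hw hzw))

theorem not_lt_first (h : IsAnchored U L R a b c) {x y : V} (hx : x ∈ U) (hy : y ∈ U)
    (hxy : x ≠ y) : ¬ R x y < L a b := fun hlt =>
  absurd (h.first x hx y hy hxy) (not_le.2 (hlt.trans_le (h.le a h.ha b h.hb h.hab)))

theorem not_last_lt (h : IsAnchored U L R a b c) {x y : V} (hx : x ∈ U) (hy : y ∈ U)
    (hxy : x ≠ y) : ¬ R a c < L x y := fun hlt =>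
  absurd (h.last x hx y hy hxy) (not_le.2 ((h.le a h.ha c h.hc h.hac).trans_lt hlt))

end IsAnchored

/-- Interval orders contain no `2 + 2`: apply this to the right ends `p`, `r` of two intervals and the
left ends `q`, `s` of two intervals lying to the right of them. -/
theorem lt_or_lt_of_lt_of_lt {α : Type*} [LinearOrder α] {p q r s : α} (h₁ : p < q) (h₂ : r < s) :
    p < s ∨ r < q := by
  rcases le_total p r with h | h
  · exact .inl (h.trans_lt h₂)
  · exact .inr (h.trans_lt h₁)

/-! ### Covering the links by stars and single pairs -/

/-- For every vertex `v`, a set of centres of stars and a set of single pairs in the link of `v`. -/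
abbrev Patch (V : Type*) := V → Finset V × Finset (Sym2 V)

/-- At every `v`, the stars and pairs of the patch contain all `{p, q}` such that `vp` and `vq` are
comparable. -/
def Patch.Covers {V : Type*} (F : Patch V) (U : Finset V) (L R : V → V → ℝ) : Prop :=
  ∀ v ∈ U, ∀ p ∈ U, ∀ q ∈ U, v ≠ p → v ≠ q → p ≠ q → R v p < L v q →
    p ∈ (F v).1 ∨ q ∈ (F v).1 ∨ s(p, q) ∈ (F v).2

/-- The weight `f s e` of a vertex at which the patch has `s` stars and `e` single pairs. -/
def Patch.weight {V : Type*} (F : Patch V) (f : ℕ → ℕ → ℕ) (v : V) : ℕ :=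
  f (F v).1.card (F v).2.card

open Classical in
/-- The patch with given values at the vertices `a`, `b`, `c`, `w`, and empty elsewhere. -/
noncomputable def patchOn {V : Type*} (a b c w : V) (A B C W : Finset V × Finset (Sym2 V)) :
    Patch V :=
  fun v => if v = a then A else if v = b then B else if v = c then C else if v = w then W else (∅, ∅)

/-! ### The comparable pairs of an anchored order -/

namespace IsAnchored
variable {V : Type*} {U : Finset V} {L R : V → V → ℝ} {a b c : V}

/-- `w` is a vertex other than `a`, `b`, `c`. -/
structure IsOuter (U : Finset V) (a b c w : V) : Prop where
  mem : w ∈ U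
  nea : a ≠ w
  neb : b ≠ w
  nec : c ≠ w

theorem IsOuter.swap {w : V} (h : IsOuter U a b c w) : IsOuter U a c b w := ⟨h.1, h.2, h.4, h.3⟩

/-! The lemmas `link_b`, `link_c`, `link_a` and `link_outer` list the pairs `vp < vq` that can occur for
`v` equal to `b`, `c`, `a`, and for any other `v`. -/

theorem link_b (h : IsAnchored U L R a b c) {p q : V} (hp : p ∈ U) (hq : q ∈ U) (hbp : b ≠ p)
    (hbq : b ≠ q) (hpq : p ≠ q) (hlt : R b p < L b q) :
    p = a ∨ (p = c ∧ IsOuter U a b c q) := by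
  have h1 := h.left_mem h.hb hp h.hb hq hbp hbq hlt
  have h2 : q ≠ a := by
    rintro rfl
    rw [h.symmL b] at hlt
    exact h.not_lt_first h.hb hp hbp hlt
  have := h.hab; have := h.hbc
  by_cases hpa : p = a
  · exact .inl hpa
  · have hpc : p = c := by tauto
    subst hpc
    exact .inr ⟨rfl, hq, h2.symm, hbq, hpq⟩

theorem link_c (h : IsAnchored U L R a b c) {p q : V} (hp : p ∈ U) (hq : q ∈ U) (hcp : c ≠ p)
    (hcq : c ≠ q) (hpq : p ≠ q) (hlt : R c p < L c q) :
    q = a ∨ (q = b ∧ IsOuter U a b c p) := by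
  have := h.reverse.link_b hq hp hcq hcp hpq.symm (neg_lt_neg hlt)
  rcases this with h1 | ⟨h1, h2, h3, h4, h5⟩
  · exact .inl h1
  · exact .inr ⟨h1, h2, h3, h5, h4⟩

theorem link_a (h : IsAnchored U L R a b c) {p q : V} (hp : p ∈ U) (hq : q ∈ U) (hap : a ≠ p)
    (haq : a ≠ q) (hlt : R a p < L a q) :
    p = b ∨ q = c ∨ (IsOuter U a b c p ∧ IsOuter U a b c q) := by
  have h1 : p ≠ c := by rintro rfl; exact h.not_last_lt h.ha hq haq hlt
  have h2 : q ≠ b := by rintro rfl; exact h.not_lt_first h.ha hp hap hlt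
  by_cases hpb : p = b
  · exact .inl hpb
  by_cases hqc : q = c
  · exact .inr (.inl hqc)
  exact .inr (.inr ⟨⟨hp, hap, Ne.symm hpb, h1.symm⟩, ⟨hq, haq, h2.symm, Ne.symm hqc⟩⟩)

theorem link_outer (h : IsAnchored U L R a b c) {v p q : V} (hv : IsOuter U a b c v)
    (hp : p ∈ U) (hq : q ∈ U) (hvp : v ≠ p) (hvq : v ≠ q) (hpq : p ≠ q) (hlt : R v p < L v q) :
    (p = c ∧ q = b ∧ R c v < L b v) ∨ (p = c ∧ q = a ∧ R c v < L a v) ∨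
      (p = a ∧ q = b ∧ R a v < L b v) := by
  have h1 := h.left_mem hv.mem hp hv.mem hq hvp hvq hlt
  have h2 := h.right_mem hv.mem hp hv.mem hq hvp hvq hlt
  rw [h.symmR v, h.symmL v] at hlt
  have := hv.nea; have := hv.neb; have := hv.nec
  have hp' : p = a ∨ p = c := by grind
  have hq' : q = a ∨ q = b := by grind
  grind

/-! The only comparable pairs that avoid `a` are of the form `bc < bv`, `cv < cb` or `cv < bv`. The
following lemmas restrict how these coexist with each other and with the pairs `cv < av`, `av < bv`
and `ap < aq`. Most of them come from the absence of `2 + 2`: one of the two resulting comparisons is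
between disjoint edges unless the vertices coincide. -/

theorem eq_of_cv_lt_bv (h : IsAnchored U L R a b c) {v w : V}
    (hv : IsOuter U a b c v) (hw : IsOuter U a b c w)
    (h₁ : R c v < L b v) (h₂ : R c w < L b w) : v = w := by
  obtain ⟨hvU, hv1, hv2, hv3⟩ := hv
  obtain ⟨hwU, hw1, hw2, hw3⟩ := hw
  have := h.hbc
  rcases lt_or_lt_of_lt_of_lt h₁ h₂ with h3 | h3
  · have := h.meet c h.hc v hvU b h.hb w hwU hv3 hw2 h3
    grind
  · have := h.meet c h.hc w hwU b h.hb v hvU hw3 hv2 h3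
    grind

theorem eq_of_cv_lt_av (h : IsAnchored U L R a b c) {v w : V}
    (hv : IsOuter U a b c v) (hw : IsOuter U a b c w)
    (h₁ : R c v < L a v) (h₂ : R c w < L a w) : v = w := by
  obtain ⟨hvU, hv1, hv2, hv3⟩ := hv
  obtain ⟨hwU, hw1, hw2, hw3⟩ := hw
  have := h.hac
  rcases lt_or_lt_of_lt_of_lt h₁ h₂ with h3 | h3
  · have := h.meet c h.hc v hvU a h.ha w hwU hv3 hw1 h3
    grind
  · have := h.meet c h.hc w hwU a h.ha v hvU hw3 hv1 h3
    grind

theorem eq_of_av_lt_bv (h : IsAnchored U L R a b c) {v w : V}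
    (hv : IsOuter U a b c v) (hw : IsOuter U a b c w)
    (h₁ : R a v < L b v) (h₂ : R a w < L b w) : v = w :=
  h.reverse.eq_of_cv_lt_av hv.swap hw.swap
    (neg_lt_neg h₁) (neg_lt_neg h₂)

theorem eq_of_cv_lt_bv_of_cw_lt_aw (h : IsAnchored U L R a b c) {v w : V}
    (hv : IsOuter U a b c v) (hw : IsOuter U a b c w)
    (h₁ : R c v < L b v) (h₂ : R c w < L a w) : v = w := by
  obtain ⟨hvU, hv1, hv2, hv3⟩ := hv
  obtain ⟨hwU, hw1, hw2, hw3⟩ := hw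
  have := h.hbc; have := h.hac
  rcases lt_or_lt_of_lt_of_lt h₁ h₂ with h3 | h3
  · have := h.meet c h.hc v hvU a h.ha w hwU hv3 hw1 h3
    grind
  · have := h.meet c h.hc w hwU b h.hb v hvU hw3 hv2 h3
    grind

theorem eq_of_cv_lt_bv_of_aw_lt_bw (h : IsAnchored U L R a b c) {v w : V}
    (hv : IsOuter U a b c v) (hw : IsOuter U a b c w)
    (h₁ : R c v < L b v) (h₂ : R a w < L b w) : v = w := by
  have h₁' : -L b v < -R c v := neg_lt_neg h₁
  exact h.reverse.eq_of_cv_lt_bv_of_cw_lt_aw hv.swap hw.swap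
    h₁' (neg_lt_neg h₂)

theorem eq_of_bc_lt_bv_of_cw_lt_cb (h : IsAnchored U L R a b c) {v w : V}
    (hv : IsOuter U a b c v) (hw : IsOuter U a b c w)
    (h₁ : R b c < L b v) (h₂ : R c w < L c b) : v = w := by
  have hbc := h.hbc
  have h3 : R c w < L b v := by
    rw [h.symmL] at h₂
    exact h₂.trans_le ((h.le b h.hb c h.hc hbc).trans h₁.le)
  have := h.meet c h.hc w hw.mem b h.hb v hv.mem hw.nec hv.neb h3
  have := hv.nec; have := hw.neb
  grind

theorem bc_lt_bw_of_cw_lt_bw (h : IsAnchored U L R a b c) {v w : V}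
    (hv : IsOuter U a b c v) (hw : IsOuter U a b c w)
    (h₁ : R b c < L b v) (h₂ : R c w < L b w) : R b c < L b w := by
  rcases lt_or_lt_of_lt_of_lt h₁ h₂ with h3 | h3
  · exact h3
  · have := h.meet c h.hc w hw.mem b h.hb v hv.mem hw.nec hv.neb h3
    have := hv.nec; have := hw.neb; have := h.hbc
    grind

theorem eq_of_bc_lt_bv_of_cw_lt_aw (h : IsAnchored U L R a b c) {v w : V}
    (hv : IsOuter U a b c v) (hw : IsOuter U a b c w)
    (h₁ : R b c < L b v) (h₂ : R c w < L a w) : v = w := by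
  have := hv.nec; have := hw.neb; have := hw.nec; have := h.hbc
  have := h.hab; have := h.hac
  rcases lt_or_lt_of_lt_of_lt h₁ h₂ with h3 | h3
  · have := h.meet b h.hb c h.hc a h.ha w hw.mem h.hbc hw.nea h3
    grind
  · have := h.meet c h.hc w hw.mem b h.hb v hv.mem hw.nec hv.neb h3
    grind

theorem bc_lt_bw_of_aw_lt_bw (h : IsAnchored U L R a b c) {v w : V}
    (hv : IsOuter U a b c v) (hw : IsOuter U a b c w)
    (h₁ : R b c < L b v) (h₂ : R a w < L b w) : R b c < L b w := by
  rcases lt_or_lt_of_lt_of_lt h₁ h₂ with h3 | h3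
  · exact h3
  · have := h.meet a h.ha w hw.mem b h.hb v hv.mem hw.nea hv.neb h3
    have := hv.nea; have := hw.neb; have := h.hab
    grind

theorem eq_of_bc_lt_bv_of_ap_lt_aq (h : IsAnchored U L R a b c) {v p q : V}
    (hv : IsOuter U a b c v) (hp : IsOuter U a b c p)
    (hq : IsOuter U a b c q) (h₁ : R b c < L b v) (h₂ : R a p < L a q) : p = v := by
  have := h.hab; have := h.hac
  rcases lt_or_lt_of_lt_of_lt h₁ h₂ with h3 | h3
  · have := h.meet b h.hb c h.hc a h.ha q hq.mem h.hbc hq.nea h3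
    have := hq.neb; have := hq.nec
    grind
  · have := h.meet a h.ha p hp.mem b h.hb v hv.mem hp.nea hv.neb h3
    have := hv.nea; have := hp.neb
    grind

theorem eq_or_eq_of_cv_lt_bv_of_ap_lt_aq (h : IsAnchored U L R a b c) {v p q : V}
    (hv : IsOuter U a b c v) (hp : IsOuter U a b c p)
    (hq : IsOuter U a b c q) (h₁ : R c v < L b v) (h₂ : R a p < L a q) : p = v ∨ q = v := by
  have := h.hab; have := h.hac
  rcases lt_or_lt_of_lt_of_lt h₁ h₂ with h3 | h3
  · have := h.meet c h.hc v hv.mem a h.ha q hq.mem hv.nec hq.nea h3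
    have := hq.nec; have := hv.nea
    grind
  · have := h.meet a h.ha p hp.mem b h.hb v hv.mem hp.nea hv.neb h3
    have := hv.nea; have := hp.neb
    grind

/-- A patch covers an anchored order if it has the star at `a` in the links of `b` and `c`, the stars at
`b` and `c` in the link of `a`, and accounts for the remaining kinds of comparable pairs. -/
theorem covers (h : IsAnchored U L R a b c) {F : Patch V}
    (hAb : b ∈ (F a).1) (hAc : c ∈ (F a).1)
    (hA : ∀ p q, IsOuter U a b c p → IsOuter U a b c q → R a p < L a q →
      p ∈ (F a).1 ∨ q ∈ (F a).1)
    (hBa : a ∈ (F b).1)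
    (hB : ∀ q, IsOuter U a b c q → R b c < L b q → c ∈ (F b).1 ∨ s(c, q) ∈ (F b).2)
    (hCa : a ∈ (F c).1)
    (hC : ∀ p, IsOuter U a b c p → R c p < L c b → b ∈ (F c).1 ∨ s(b, p) ∈ (F c).2)
    (hcb : ∀ v, IsOuter U a b c v → R c v < L b v → s(b, c) ∈ (F v).2)
    (hca : ∀ v, IsOuter U a b c v → R c v < L a v → s(a, c) ∈ (F v).2)
    (hab : ∀ v, IsOuter U a b c v → R a v < L b v → s(a, b) ∈ (F v).2) :
    F.Covers U L R := by
  intro v hv p hp q hq hvp hvq hpq hlt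
  by_cases hva : a = v
  · subst hva
    rcases h.link_a hp hq hvp hvq hlt with rfl | rfl | ⟨h1, h2⟩
    · exact .inl hAb
    · exact .inr (.inl hAc)
    · rcases hA p q h1 h2 hlt with h3 | h3
      · exact .inl h3
      · exact .inr (.inl h3)
  by_cases hvb : b = v
  · subst hvb
    rcases h.link_b hp hq hvp hvq hpq hlt with rfl | ⟨rfl, h1⟩
    · exact .inl hBa
    · rcases hB q h1 hlt with h3 | h3
      · exact .inl h3
      · exact .inr (.inr h3)
  by_cases hvc : c = v
  · subst hvc
    rcases h.link_c hp hq hvp hvq hpq hlt with rfl | ⟨rfl, h1⟩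
    · exact .inr (.inl hCa)
    · rcases hC p h1 hlt with h3 | h3
      · exact .inr (.inl h3)
      · exact .inr (.inr (Sym2.eq_swap ▸ h3))
  have hO : IsOuter U a b c v := ⟨hv, hva, hvb, hvc⟩
  rcases h.link_outer hO hp hq hvp hvq hpq hlt with
    ⟨rfl, rfl, h3⟩ | ⟨rfl, rfl, h3⟩ | ⟨rfl, rfl, h3⟩
  · exact .inr (.inr (Sym2.eq_swap ▸ hcb v hO h3))
  · exact .inr (.inr (Sym2.eq_swap ▸ hca v hO h3))
  · exact .inr (.inr (hab v hO h3))

end IsAnchored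

theorem Patch.Covers.of_reverse {V : Type*} {U : Finset V} {L R : V → V → ℝ} {F : Patch V}
    (h : F.Covers U (fun x y => -R x y) (fun x y => -L x y)) : F.Covers U L R := by
  intro v hv p hp q hq hvp hvq hpq hlt
  have := h v hv q hq p hp hvq hvp hpq.symm (neg_lt_neg hlt)
  rw [Sym2.eq_swap] at this
  tauto

theorem sum_weight_patchOn {V : Type*} {U : Finset V} {a b c w : V} (ha : a ∈ U) (hb : b ∈ U)
    (hc : c ∈ U) (hw : w ∈ U) (hab : a ≠ b) (hac : a ≠ c) (hbc : b ≠ c) (haw : a ≠ w)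
    (hbw : b ≠ w) (hcw : c ≠ w) (A B C W : Finset V × Finset (Sym2 V)) {f : ℕ → ℕ → ℕ}
    (hf : f 0 0 = 0) :
    ∑ v ∈ U, (patchOn a b c w A B C W).weight f v =
      f A.1.card A.2.card + f B.1.card B.2.card + f C.1.card C.2.card + f W.1.card W.2.card := by
  classical
  have h1 : ∀ v, (patchOn a b c w A B C W).weight f v =
      (if v = a then f A.1.card A.2.card else 0) + (if v = b then f B.1.card B.2.card else 0) +
      (if v = c then f C.1.card C.2.card else 0) +
      (if v = w then f W.1.card W.2.card else 0) := by
    intro v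
    unfold Patch.weight patchOn
    by_cases h1 : v = a
    · subst h1; simp [*]
    by_cases h2 : v = b
    · subst h2; simp [*]
    by_cases h3 : v = c
    · subst h3; simp [*]
    by_cases h4 : v = w
    · subst h4; simp [*]
    simp [*]
  simp [h1, Finset.sum_add_distrib, ha, hb, hc, hw]

/-! ### Orders with a comparable pair avoiding `a` -/

/-- The largest weight of the three possible shapes of a small patch: each summand `f s e` stands for
a vertex with `s` stars and `e` single pairs. -/
def profileMax (f : ℕ → ℕ → ℕ) : ℕ :=
  max (f 2 0 + f 1 1 + f 1 1 + f 0 3)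
    (max (f 3 0 + f 1 1 + f 1 0 + f 0 2) (f 2 0 + f 2 0 + f 1 0 + f 0 2))

/-- The order is covered by a patch whose total weight is bounded by `profileMax`, for all monotone
weights. -/
def HasSmallPatch {V : Type*} (U : Finset V) (L R : V → V → ℝ) : Prop :=
  ∃ F : Patch V, F.Covers U L R ∧ ∀ f : ℕ → ℕ → ℕ, f 0 0 = 0 →
    (∀ s s' e e', s ≤ s' → e ≤ e' → f s e ≤ f s' e') → ∑ v ∈ U, F.weight f v ≤ profileMax f

theorem HasSmallPatch.of_reverse {V : Type*} {U : Finset V} {L R : V → V → ℝ}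
    (h : HasSmallPatch U (fun x y => -R x y) (fun x y => -L x y)) : HasSmallPatch U L R := by
  obtain ⟨F, hF, hf⟩ := h
  exact ⟨F, hF.of_reverse, hf⟩

namespace IsAnchored
variable {V : Type*} {U : Finset V} {L R : V → V → ℝ} {a b c : V}

theorem sum_weight_patchOn_le (h : IsAnchored U L R a b c) {w : V} (hw : IsOuter U a b c w)
    {A B C W : Finset V × Finset (Sym2 V)} {f : ℕ → ℕ → ℕ} (hf : f 0 0 = 0)
    (hm : ∀ s s' e e', s ≤ s' → e ≤ e' → f s e ≤ f s' e') {s₁ s₂ s₃ s₄ e₁ e₂ e₃ e₄ : ℕ}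
    (h₁ : A.1.card ≤ s₁ ∧ A.2.card ≤ e₁) (h₂ : B.1.card ≤ s₂ ∧ B.2.card ≤ e₂)
    (h₃ : C.1.card ≤ s₃ ∧ C.2.card ≤ e₃) (h₄ : W.1.card ≤ s₄ ∧ W.2.card ≤ e₄) :
    ∑ v ∈ U, (patchOn a b c w A B C W).weight f v ≤ f s₁ e₁ + f s₂ e₂ + f s₃ e₃ + f s₄ e₄ := by
  rw [sum_weight_patchOn h.ha h.hb h.hc hw.mem h.hab h.hac h.hbc hw.nea hw.neb hw.nec _ _ _ _ hf]
  have := hm _ _ _ _ h₁.1 h₁.2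
  have := hm _ _ _ _ h₂.1 h₂.2
  have := hm _ _ _ _ h₃.1 h₃.2
  have := hm _ _ _ _ h₄.1 h₄.2
  omega

/-- The pairs `bc < bq` and `bc < bq'` exclude all pairs `cv < cb` and `cv < av`, and all pairs `ap < aq`
other than those with `p = b` or `q = c`. -/
theorem hasSmallPatch_of_two (h : IsAnchored U L R a b c) {q q' : V} (hq : IsOuter U a b c q)
    (hq' : IsOuter U a b c q') (hne : q ≠ q') (h₁ : R b c < L b q) (h₂ : R b c < L b q') :
    HasSmallPatch U L R := by
  classical
  have hab := h.hab; have hac := h.hac; have hbc := h.hbc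
  obtain ⟨w, hw, hw1⟩ : ∃ w, IsOuter U a b c w ∧ ∀ v, IsOuter U a b c v →
      (R c v < L b v ∨ R a v < L b v) → v = w := by
    by_cases hex : ∃ w, IsOuter U a b c w ∧ (R c w < L b w ∨ R a w < L b w)
    · obtain ⟨w, hw, hw1⟩ := hex
      refine ⟨w, hw, fun v hv hv1 => ?_⟩
      rcases hw1 with hw1 | hw1 <;> rcases hv1 with hv1 | hv1
      · exact h.eq_of_cv_lt_bv hv hw hv1 hw1
      · exact (h.eq_of_cv_lt_bv_of_aw_lt_bw hw hv hw1 hv1).symm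
      · exact h.eq_of_cv_lt_bv_of_aw_lt_bw hv hw hv1 hw1
      · exact h.eq_of_av_lt_bv hv hw hv1 hw1
    · exact ⟨q, hq, fun v hv hv1 => absurd ⟨v, hv, hv1⟩ hex⟩
  have nwa := hw.nea; have nwb := hw.neb; have nwc := hw.nec
  refine ⟨patchOn a b c w ({b, c}, ∅) ({a, c}, ∅) ({a}, ∅) (∅, {s(b, c), s(a, b)}),
    h.covers ?_ ?_ ?_ ?_ ?_ ?_ ?_ ?_ ?_ ?_, fun f hf hm => ?_⟩
  · simp [patchOn]
  · simp [patchOn]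
  · intro p r hp hr hlt
    exact absurd ((h.eq_of_bc_lt_bv_of_ap_lt_aq hq hp hr h₁ hlt).symm.trans
      (h.eq_of_bc_lt_bv_of_ap_lt_aq hq' hp hr h₂ hlt)) hne
  · simp [patchOn, hab.symm]
  · simp [patchOn, hab.symm]
  · simp [patchOn, hac.symm, hbc.symm]
  · intro p hp hlt
    exact absurd ((h.eq_of_bc_lt_bv_of_cw_lt_cb hq hp h₁ hlt).trans
      (h.eq_of_bc_lt_bv_of_cw_lt_cb hq' hp h₂ hlt).symm) hne
  · intro v hv hlt
    obtain rfl := hw1 v hv (.inl hlt)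
    simp [patchOn, nwa.symm, nwb.symm, nwc.symm]
  · intro v hv hlt
    exact absurd ((h.eq_of_bc_lt_bv_of_cw_lt_aw hq hv h₁ hlt).trans
      (h.eq_of_bc_lt_bv_of_cw_lt_aw hq' hv h₂ hlt).symm) hne
  · intro v hv hlt
    obtain rfl := hw1 v hv (.inr hlt)
    simp [patchOn, nwa.symm, nwb.symm, nwc.symm]
  · refine (h.sum_weight_patchOn_le hw hf hm (s₁ := 2) (e₁ := 0) (s₂ := 2) (e₂ := 0) (s₃ := 1)
      (e₃ := 0) (s₄ := 0) (e₄ := 2) ?_ ?_ ?_ ?_).trans ?_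
    · simp [Finset.card_le_two]
    · simp [Finset.card_le_two]
    · simp
    · simp [Finset.card_le_two]
    · simp [profileMax]

/-- Some comparable pair avoiding `a` involves the outer vertex `w`, and no other outer vertex occurs
in a comparable pair of one of the kinds `bc < bv`, `cv < cb`, `cv < bv`, `cv < av`, `av < bv`. -/
structure IsFocus (U : Finset V) (L R : V → V → ℝ) (a b c w : V) : Prop where
  outer : IsOuter U a b c w
  avoids : R b c < L b w ∨ R c w < L c b ∨ R c w < L b w
  eq_of_bc_lt_bv : ∀ v, IsOuter U a b c v → R b c < L b v → v = w
  eq_of_cv_lt_cb : ∀ v, IsOuter U a b c v → R c v < L c b → v = w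
  eq_of_cv_lt_bv : ∀ v, IsOuter U a b c v → R c v < L b v → v = w
  eq_of_cv_lt_av : ∀ v, IsOuter U a b c v → R c v < L a v → v = w
  eq_of_av_lt_bv : ∀ v, IsOuter U a b c v → R a v < L b v → v = w

theorem IsFocus.reverse {w : V} (hw : IsFocus U L R a b c w) :
    IsFocus U (fun x y => -R x y) (fun x y => -L x y) a c b w where
  outer := hw.outer.swap
  avoids := by
    simp only [neg_lt_neg_iff]
    exact or_left_comm.1 hw.avoids
  eq_of_bc_lt_bv v hv hlt := hw.eq_of_cv_lt_cb v hv.swap (neg_lt_neg_iff.1 hlt)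
  eq_of_cv_lt_cb v hv hlt := hw.eq_of_bc_lt_bv v hv.swap (neg_lt_neg_iff.1 hlt)
  eq_of_cv_lt_bv v hv hlt := hw.eq_of_cv_lt_bv v hv.swap (neg_lt_neg_iff.1 hlt)
  eq_of_cv_lt_av v hv hlt := hw.eq_of_av_lt_bv v hv.swap (neg_lt_neg_iff.1 hlt)
  eq_of_av_lt_bv v hv hlt := hw.eq_of_cv_lt_av v hv.swap (neg_lt_neg_iff.1 hlt)

theorem IsFocus.hasSmallPatch_of_no_inner {w : V} (hF : IsFocus U L R a b c w)
    (h : IsAnchored U L R a b c)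
    (hI : ∀ p q, IsOuter U a b c p → IsOuter U a b c q → ¬ R a p < L a q) :
    HasSmallPatch U L R := by
  classical
  have hab := h.hab; have hac := h.hac; have hbc := h.hbc
  have hw := hF.outer
  have nwa := hw.nea; have nwb := hw.neb; have nwc := hw.nec
  refine ⟨patchOn a b c w ({b, c}, ∅) ({a}, {s(c, w)}) ({a}, {s(b, w)})
    (∅, {s(b, c), s(a, c), s(a, b)}),
    h.covers ?_ ?_ ?_ ?_ ?_ ?_ ?_ ?_ ?_ ?_, fun f hf hm => ?_⟩
  · simp [patchOn]
  · simp [patchOn]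
  · exact fun p q hp hq hlt => absurd hlt (hI p q hp hq)
  · simp [patchOn, hab.symm]
  · intro q hq hlt
    simp [patchOn, hab.symm, hF.eq_of_bc_lt_bv q hq hlt]
  · simp [patchOn, hac.symm, hbc.symm]
  · intro p hp hlt
    simp [patchOn, hac.symm, hbc.symm, hF.eq_of_cv_lt_cb p hp hlt]
  · intro v hv hlt
    simp [patchOn, nwa.symm, nwb.symm, nwc.symm, hF.eq_of_cv_lt_bv v hv hlt]
  · intro v hv hlt
    simp [patchOn, nwa.symm, nwb.symm, nwc.symm, hF.eq_of_cv_lt_av v hv hlt]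
  · intro v hv hlt
    simp [patchOn, nwa.symm, nwb.symm, nwc.symm, hF.eq_of_av_lt_bv v hv hlt]
  · refine (h.sum_weight_patchOn_le hw hf hm (s₁ := 2) (e₁ := 0) (s₂ := 1) (e₂ := 1) (s₃ := 1)
      (e₃ := 1) (s₄ := 0) (e₄ := 3) ?_ ?_ ?_ ?_).trans ?_
    · simp [Finset.card_le_two]
    · simp
    · simp
    · simp [Finset.card_le_three]
    · simp [profileMax]

theorem IsFocus.inner {w p q : V} (hF : IsFocus U L R a b c w)
    (h : IsAnchored U L R a b c) (hp : IsOuter U a b c p) (hq : IsOuter U a b c q)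
    (hlt : R a p < L a q) : p = w ∨ q = w := by
  rcases hF.avoids with h1 | h1 | h1
  · exact .inl (h.eq_of_bc_lt_bv_of_ap_lt_aq hF.outer hp hq h1 hlt)
  · exact .inr (h.reverse.eq_of_bc_lt_bv_of_ap_lt_aq hF.outer.swap hq.swap hp.swap
      (neg_lt_neg h1) (neg_lt_neg hlt))
  · exact h.eq_or_eq_of_cv_lt_bv_of_ap_lt_aq hF.outer hp hq h1 hlt

/-- A pair `aw < aq₀` adds the star at `w` to the link of `a`, but excludes the pairs `cv < cb` and
`cv < av`. -/
theorem IsFocus.hasSmallPatch_of_inner {w q₀ : V} (hF : IsFocus U L R a b c w)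
    (h : IsAnchored U L R a b c) (hq₀ : IsOuter U a b c q₀) (hne : w ≠ q₀)
    (hlt₀ : R a w < L a q₀) :
    HasSmallPatch U L R := by
  classical
  have hab := h.hab; have hac := h.hac; have hbc := h.hbc
  have hw := hF.outer
  have nwa := hw.nea; have nwb := hw.neb; have nwc := hw.nec
  refine ⟨patchOn a b c w ({b, c, w}, ∅) ({a}, {s(c, w)}) ({a}, ∅) (∅, {s(b, c), s(a, b)}),
    h.covers ?_ ?_ ?_ ?_ ?_ ?_ ?_ ?_ ?_ ?_, fun f hf hm => ?_⟩
  · simp [patchOn]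
  · simp [patchOn]
  · intro p q hp hq hlt
    rcases hF.inner h hp hq hlt with rfl | rfl <;> simp [patchOn]
  · simp [patchOn, hab.symm]
  · intro q hq hlt
    simp [patchOn, hab.symm, hF.eq_of_bc_lt_bv q hq hlt]
  · simp [patchOn, hac.symm, hbc.symm]
  · intro p hp hlt
    obtain rfl := hF.eq_of_cv_lt_cb p hp hlt
    exact absurd (h.reverse.eq_of_bc_lt_bv_of_ap_lt_aq hp.swap hq₀.swap hp.swap
      (neg_lt_neg hlt) (neg_lt_neg hlt₀)) hne.symm
  · intro v hv hlt
    simp [patchOn, nwa.symm, nwb.symm, nwc.symm, hF.eq_of_cv_lt_bv v hv hlt]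
  · intro v hv hlt
    -- `cw < aw < aq₀` would compare two disjoint edges.
    obtain rfl := hF.eq_of_cv_lt_av v hv hlt
    have h1 : R c v < L a q₀ :=
      hlt.trans_le ((h.le a h.ha v hv.mem nwa).trans hlt₀.le)
    have := h.meet c h.hc v hv.mem a h.ha q₀ hq₀.mem nwc hq₀.nea h1
    have := hq₀.nec
    grind
  · intro v hv hlt
    simp [patchOn, nwa.symm, nwb.symm, nwc.symm, hF.eq_of_av_lt_bv v hv hlt]
  · refine (h.sum_weight_patchOn_le hw hf hm (s₁ := 3) (e₁ := 0) (s₂ := 1) (e₂ := 1) (s₃ := 1)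
      (e₃ := 0) (s₄ := 0) (e₄ := 2) ?_ ?_ ?_ ?_).trans ?_
    · simp [Finset.card_le_three]
    · simp
    · simp
    · simp [Finset.card_le_two]
    · simp [profileMax]

theorem IsFocus.hasSmallPatch {w : V} (hF : IsFocus U L R a b c w)
    (h : IsAnchored U L R a b c) : HasSmallPatch U L R := by
  by_cases hI : ∀ p q, IsOuter U a b c p → IsOuter U a b c q → ¬ R a p < L a q
  · exact hF.hasSmallPatch_of_no_inner h hI
  push Not at hI
  obtain ⟨p, q, hp, hq, hlt⟩ := hI
  have hne : p ≠ q := by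
    rintro rfl
    exact absurd hlt (not_lt.2 (h.le a h.ha p hp.mem hp.nea))
  rcases hF.inner h hp hq hlt with rfl | rfl
  · exact hF.hasSmallPatch_of_inner h hq hne hlt
  · exact (hF.reverse.hasSmallPatch_of_inner h.reverse hp.swap hne.symm
      (neg_lt_neg hlt)).of_reverse

theorem exists_isFocus (h : IsAnchored U L R a b c)
    (hK : ∀ q q', IsOuter U a b c q → IsOuter U a b c q' → R b c < L b q → R b c < L b q' → q = q')
    (hL : ∀ q q', IsOuter U a b c q → IsOuter U a b c q' → R c q < L c b → R c q' < L c b → q = q')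
    (hex : ∃ w, IsOuter U a b c w ∧ (R b c < L b w ∨ R c w < L c b ∨ R c w < L b w)) :
    ∃ w, IsFocus U L R a b c w := by
  have key : ∀ {b c : V} {L R : V → V → ℝ}, IsAnchored U L R a b c →
    (∀ q q', IsOuter U a b c q → IsOuter U a b c q' → R b c < L b q → R b c < L b q' → q = q') →
    ∀ w, IsOuter U a b c w → R b c < L b w → IsFocus U L R a b c w := by
    intro b c L R h hK w hw h1
    exact ⟨hw, .inl h1, fun v hv hlt => hK v w hv hw hlt h1,
      fun v hv hlt => (h.eq_of_bc_lt_bv_of_cw_lt_cb hw hv h1 hlt).symm,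
      fun v hv hlt => hK v w hv hw (h.bc_lt_bw_of_cw_lt_bw hw hv h1 hlt) h1,
      fun v hv hlt => (h.eq_of_bc_lt_bv_of_cw_lt_aw hw hv h1 hlt).symm,
      fun v hv hlt => hK v w hv hw (h.bc_lt_bw_of_aw_lt_bw hw hv h1 hlt) h1⟩
  by_cases h1 : ∃ w, IsOuter U a b c w ∧ R b c < L b w
  · obtain ⟨w, hw, h1⟩ := h1
    exact ⟨w, key h hK w hw h1⟩
  by_cases h2 : ∃ w, IsOuter U a b c w ∧ R c w < L c b
  · obtain ⟨w, hw, h2⟩ := h2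
    have := (key h.reverse (fun q q' hq hq' h3 h4 => hL q q' hq.swap hq'.swap
      (neg_lt_neg_iff.1 h3) (neg_lt_neg_iff.1 h4)) w hw.swap (neg_lt_neg h2)).reverse
    simp only [neg_neg] at this
    exact ⟨w, this⟩
  obtain ⟨w, hw, h3⟩ := hex
  have h3 : R c w < L b w := by
    rcases h3 with h3 | h3 | h3
    · exact absurd ⟨w, hw, h3⟩ h1
    · exact absurd ⟨w, hw, h3⟩ h2
    · exact h3
  exact ⟨w, hw, .inr (.inr h3), fun v hv hlt => absurd ⟨v, hv, hlt⟩ h1,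
    fun v hv hlt => absurd ⟨v, hv, hlt⟩ h2, fun v hv hlt => h.eq_of_cv_lt_bv hv hw hlt h3,
    fun v hv hlt => (h.eq_of_cv_lt_bv_of_cw_lt_aw hw hv h3 hlt).symm,
    fun v hv hlt => (h.eq_of_cv_lt_bv_of_aw_lt_bw hw hv h3 hlt).symm⟩

/-- An anchored order in which some comparable pair avoids `a` has a small patch. -/
theorem hasSmallPatch (h : IsAnchored U L R a b c)
    (hex : ∃ w, IsOuter U a b c w ∧ (R b c < L b w ∨ R c w < L c b ∨ R c w < L b w)) :
    HasSmallPatch U L R := by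
  by_cases hK : ∀ q q', IsOuter U a b c q → IsOuter U a b c q' → R b c < L b q → R b c < L b q' →
    q = q'
  · by_cases hL : ∀ q q', IsOuter U a b c q → IsOuter U a b c q' → R c q < L c b → R c q' < L c b →
      q = q'
    · obtain ⟨w, hF⟩ := h.exists_isFocus hK hL hex
      exact hF.hasSmallPatch h
    · push Not at hL
      obtain ⟨q, q', hq, hq', h1, h2, hne⟩ := hL
      exact (h.reverse.hasSmallPatch_of_two hq.swap hq'.swap hne
        (neg_lt_neg h1) (neg_lt_neg h2)).of_reverse
  · push Not at hK
    obtain ⟨q, q', hq, hq', h1, h2, hne⟩ := hK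
    exact h.hasSmallPatch_of_two hq hq' hne h1 h2

/-! ### Orders whose comparable pairs all use an edge at `a` -/

/-- If no pair of the three listed kinds is comparable, then every comparable pair has an edge at `a`. -/
theorem mem_of_lt (h : IsAnchored U L R a b c)
    (hex : ¬ ∃ w, IsOuter U a b c w ∧ (R b c < L b w ∨ R c w < L c b ∨ R c w < L b w))
    {x y z t : V} (hx : x ∈ U) (hy : y ∈ U) (hz : z ∈ U) (ht : t ∈ U) (hxy : x ≠ y) (hzt : z ≠ t)
    (hlt : R x y < L z t) : a = x ∨ a = y ∨ a = z ∨ a = t := by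
  by_contra! hna
  obtain ⟨h1, h2, h3, h4⟩ := hna
  have key : ∀ y t, y ∈ U → t ∈ U → a ≠ y → a ≠ t → c ≠ y → b ≠ t → ¬ R c y < L b t := by
    intro y t hy ht hay hat hcy hbt hlt
    have hbc := h.hbc
    rcases h.meet c h.hc y hy b h.hb t ht hcy hbt hlt with h5 | rfl | rfl | rfl
    · exact hbc h5.symm
    · by_cases hyb : b = y
      · subst hyb
        rw [h.symmL b] at hlt
        exact absurd hlt (not_lt.2 (h.le _ ht _ hy hcy))
      · rw [h.symmL b] at hlt
        exact hex ⟨y, ⟨hy, hay, hyb, hcy⟩, .inr (.inl hlt)⟩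
    · by_cases htc : c = t
      · subst htc
        rw [h.symmL y] at hlt
        exact absurd hlt (not_lt.2 (h.le _ ht _ hy hcy))
      · rw [h.symmR c] at hlt
        exact hex ⟨t, ⟨ht, hat, hbt, htc⟩, .inl hlt⟩
    · exact hex ⟨y, ⟨hy, hay, hbt, hcy⟩, .inr (.inr hlt)⟩
  have hl := h.left_mem hx hy hz ht hxy hzt hlt
  have hr := h.right_mem hx hy hz ht hxy hzt hlt
  have sL := h.symmL z t; have sR := h.symmR x y
  rcases hl with rfl | rfl | rfl | rfl
  · exact h1 rfl
  · rcases hr with rfl | rfl | rfl | rfl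
    · exact h3 rfl
    · exact key y t hy ht h2 h4 hxy hzt hlt
    · exact h4 rfl
    · exact key y z hy hz h2 h3 hxy hzt.symm (sL ▸ hlt)
  · exact h2 rfl
  · rcases hr with rfl | rfl | rfl | rfl
    · exact h3 rfl
    · exact key x t hx ht h1 h4 hxy.symm hzt (sR ▸ hlt)
    · exact h4 rfl
    · exact key x z hx hz h1 h3 hxy.symm hzt.symm (sL ▸ sR ▸ hlt)

/-- In an order all of whose comparable pairs have an edge at `a`, the link of any vertex other than `a`
contributes at most the star at `a`, and this only for `b` and `c`, or pairs from `{a, b, c}`. The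
whole of `U` is used as the set of stars at `a`. -/
theorem exists_covers_of_star (h : IsAnchored U L R a b c)
    (hex : ¬ ∃ w, IsOuter U a b c w ∧ (R b c < L b w ∨ R c w < L c b ∨ R c w < L b w))
    {f : ℕ → ℕ → ℕ} (hf : f 0 0 = 0) (hm : ∀ s s' e e', s ≤ s' → e ≤ e' → f s e ≤ f s' e')
    (hf2 : f 0 2 ≤ 2 * f 0 1) {M : ℕ} (hM : f U.card 0 ≤ M) :
    ∃ F : Patch V, F.Covers U L R ∧ ∑ v ∈ U, F.weight f v ≤ M + 2 * f 1 0 + 2 * f 0 1 := by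
  classical
  have hab := h.hab; have hac := h.hac; have hbc := h.hbc
  have hOa : ∀ v, IsOuter U a b c v → v ≠ a ∧ v ≠ b ∧ v ≠ c :=
    fun v hv => ⟨hv.nea.symm, hv.neb.symm, hv.nec.symm⟩
  let F : Patch V := fun v =>
    if v = a then (U, ∅) else if v = b then ({a}, ∅) else if v = c then ({a}, ∅) else
      (∅, (if R c v < L a v then {s(a, c)} else ∅) ∪ (if R a v < L b v then {s(a, b)} else ∅))
  refine ⟨F, h.covers ?_ ?_ ?_ ?_ ?_ ?_ ?_ ?_ ?_ ?_, ?_⟩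
  · simp [F, h.hb]
  · simp [F, h.hc]
  · intro p q hp hq hlt
    simp [F, hp.mem]
  · simp [F, hab.symm]
  · exact fun q hq hlt => absurd ⟨q, hq, .inl hlt⟩ hex
  · simp [F, hac.symm, hbc.symm]
  · exact fun q hq hlt => absurd ⟨q, hq, .inr (.inl hlt)⟩ hex
  · exact fun q hq hlt => absurd ⟨q, hq, .inr (.inr hlt)⟩ hex
  · intro v hv hlt
    simp [F, hOa v hv, hlt]
  · intro v hv hlt
    simp [F, hOa v hv, hlt]
  · have h1 : ∀ v ∈ U, F.weight f v ≤ (if v = a then M else 0) + (if v = b then f 1 0 else 0) +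
        (if v = c then f 1 0 else 0) + (if IsOuter U a b c v ∧ R c v < L a v then f 0 1 else 0) +
        (if IsOuter U a b c v ∧ R a v < L b v then f 0 1 else 0) := by
      intro v hv
      unfold Patch.weight
      by_cases h1 : v = a
      · subst h1; simp [F]; omega
      by_cases h2 : v = b
      · subst h2; simp [F, h1]; omega
      by_cases h3 : v = c
      · subst h3; simp [F, h1, h2]; omega
      have hO : IsOuter U a b c v := ⟨hv, Ne.symm h1, Ne.symm h2, Ne.symm h3⟩
      by_cases h4 : R c v < L a v <;> by_cases h5 : R a v < L b v
      · simp only [F, h1, h2, h3, h4, h5, hO, if_true, if_false, and_self]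
        have := hm 0 0 _ _ le_rfl (Finset.card_le_two (a := s(a, c)) (b := s(a, b)))
        simp only [Finset.card_empty]
        rw [← Finset.insert_eq]
        omega
      all_goals simp [F, h1, h2, h3, h4, h5, hO, hf]
    refine (Finset.sum_le_sum h1).trans ?_
    have hX : (U.filter fun v => IsOuter U a b c v ∧ R c v < L a v).card ≤ 1 := by
      refine Finset.card_le_one.2 fun v hv w hw => ?_
      simp only [Finset.mem_filter] at hv hw
      exact h.eq_of_cv_lt_av hv.2.1 hw.2.1 hv.2.2 hw.2.2
    have hY : (U.filter fun v => IsOuter U a b c v ∧ R a v < L b v).card ≤ 1 := by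
      refine Finset.card_le_one.2 fun v hv w hw => ?_
      simp only [Finset.mem_filter] at hv hw
      exact h.eq_of_av_lt_bv hv.2.1 hw.2.1 hv.2.2 hw.2.2
    have hX' := Nat.mul_le_mul_right (f 0 1) hX
    have hY' := Nat.mul_le_mul_right (f 0 1) hY
    simp only [Finset.sum_add_distrib, Finset.sum_ite_eq', h.ha, h.hb, h.hc, if_true,
      ← Finset.sum_filter, Finset.sum_const, smul_eq_mul]
    omega

end IsAnchored

/-! ### The weight for five vertices -/

/-- A weight for covering `K₄`, the link of a vertex in `K₅`, by `s` stars and `e` single pairs. The value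
is `16` exactly when `(4 - s).choose 2 ≤ e`, the least that suffices for `K₄`. The other values solve the
linear inequalities that make the weight subadditive and keep the total of every interval order below
`5 * 16 / 2`. -/
def petersenWeight (s e : ℕ) : ℕ :=
  if 3 ≤ s ∨ (s = 2 ∧ 1 ≤ e) ∨ (s = 1 ∧ 3 ≤ e) ∨ 6 ≤ e then 16
  else if s = 2 ∨ (s = 1 ∧ e = 2) ∨ e = 5 then 12
  else if (s = 1 ∧ e = 1) ∨ e = 3 ∨ e = 4 then 9
  else if s = 1 ∨ e = 2 then 7
  else if e = 1 then 4 else 0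

theorem petersenWeight_mono {s s' e e' : ℕ} (hs : s ≤ s') (he : e ≤ e') :
    petersenWeight s e ≤ petersenWeight s' e' := by
  unfold petersenWeight
  split_ifs <;> omega

/-- The weight depends only on truncations, which makes its subadditivity a finite check. -/
theorem petersenWeight_min (s e : ℕ) :
    petersenWeight (min s 3) (min e 6) = petersenWeight s e := by
  unfold petersenWeight
  congr 1
  · simp only [eq_iff_iff]; omega
  congr 1
  · simp only [eq_iff_iff]; omega
  congr 1
  · simp only [eq_iff_iff]; omega
  congr 1
  · simp only [eq_iff_iff]; omega
  congr 1
  simp only [eq_iff_iff]; omega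

theorem petersenWeight_add_le (s s' e e' : ℕ) :
    petersenWeight (s + s') (e + e') ≤ petersenWeight s e + petersenWeight s' e' := by
  have key : ∀ s < 4, ∀ s' < 4, ∀ e < 7, ∀ e' < 7,
      petersenWeight (s + s') (e + e') ≤ petersenWeight s e + petersenWeight s' e' := by decide
  have h := key (min s 3) (by omega) (min s' 3) (by omega) (min e 6) (by omega) (min e' 6)
    (by omega)
  rw [petersenWeight_min, petersenWeight_min, ← petersenWeight_min (min s 3 + min s' 3)] at h
  rw [← petersenWeight_min (s + s')]
  rwa [show min (s + s') 3 = min (min s 3 + min s' 3) 3 by omega,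
    show min (e + e') 6 = min (min e 6 + min e' 6) 6 by omega]

theorem le_petersenWeight {s e : ℕ} (h : (4 - s).choose 2 ≤ e) : 16 ≤ petersenWeight s e := by
  unfold petersenWeight
  rcases Nat.lt_or_ge s 3 with hs | hs
  · interval_cases s <;> simp [Nat.choose] at h <;> split_ifs <;> omega
  · simp [hs]

theorem petersenWeight_sum_le {ι : Type*} (I : Finset ι) (s e : ι → ℕ) :
    petersenWeight (∑ i ∈ I, s i) (∑ i ∈ I, e i) ≤ ∑ i ∈ I, petersenWeight (s i) (e i) := by
  classical
  induction I using Finset.induction_on with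
  | empty => simp [petersenWeight]
  | insert i I hi ih =>
    rw [Finset.sum_insert hi, Finset.sum_insert hi, Finset.sum_insert hi]
    exact (petersenWeight_add_le _ _ _ _).trans (by omega)

/-! ### Bounding a single order -/

theorem IsLineOrder.exists_petersenWeight_le {V : Type*} {U : Finset V} {L R : V → V → ℝ}
    (h : IsLineOrder U L R) :
    ∃ F : Patch V, F.Covers U L R ∧ ∑ v ∈ U, F.weight petersenWeight v ≤ 39 := by
  by_cases hne : ∃ v ∈ U, ∃ p ∈ U, ∃ q ∈ U, v ≠ p ∧ v ≠ q ∧ R v p < L v q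
  · obtain ⟨v, hv, p, hp, q, hq, hvp, hvq, hlt⟩ := hne
    obtain ⟨a, b, c, h'⟩ := h.exists_isAnchored hv hp hv hq hvp hvq hlt
    by_cases hex : ∃ w, IsAnchored.IsOuter U a b c w ∧
        (R b c < L b w ∨ R c w < L c b ∨ R c w < L b w)
    · obtain ⟨F, hF, hw⟩ := h'.hasSmallPatch hex
      refine ⟨F, hF, (hw _ ?_ fun s s' e e' => petersenWeight_mono).trans ?_⟩
      · simp [petersenWeight]
      · simp [petersenWeight, profileMax]
    · obtain ⟨F, hF, hw⟩ := h'.exists_covers_of_star hex (f := petersenWeight) (M := 16)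
        (by simp [petersenWeight]) (fun s s' e e' => petersenWeight_mono)
        (by simp [petersenWeight]) (by unfold petersenWeight; split_ifs <;> omega)
      refine ⟨F, hF, hw.trans ?_⟩
      simp [petersenWeight]
  · refine ⟨fun _ => (∅, ∅), ?_, ?_⟩
    · intro v hv p hp q hq hvp hvq hpq hlt
      exact absurd ⟨v, hv, p, hp, q, hq, hvp, hvq, hlt⟩ hne
    · simp [Patch.weight, petersenWeight]

theorem IsLineOrder.hasSmallPatch_or_star {V : Type*} {U : Finset V} {L R : V → V → ℝ}
    (h : IsLineOrder U L R) (hU : U.Nonempty) :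
    HasSmallPatch U L R ∨ ∃ a ∈ U, ∀ v ∈ U, ∀ p ∈ U, ∀ q ∈ U, v ≠ p → v ≠ q → R v p < L v q →
      a = v ∨ a = p ∨ a = q := by
  by_cases hne : ∃ v ∈ U, ∃ p ∈ U, ∃ q ∈ U, v ≠ p ∧ v ≠ q ∧ R v p < L v q
  · obtain ⟨v, hv, p, hp, q, hq, hvp, hvq, hlt⟩ := hne
    obtain ⟨a, b, c, h'⟩ := h.exists_isAnchored hv hp hv hq hvp hvq hlt
    by_cases hex : ∃ w, IsAnchored.IsOuter U a b c w ∧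
        (R b c < L b w ∨ R c w < L c b ∨ R c w < L b w)
    · exact .inl (h'.hasSmallPatch hex)
    · refine .inr ⟨a, h'.ha, fun v hv p hp q hq hvp hvq hlt => ?_⟩
      have := h'.mem_of_lt hex hv hp hv hq hvp hvq hlt
      tauto
  · obtain ⟨a, ha⟩ := hU
    exact .inr ⟨a, ha, fun v hv p hp q hq hvp hvq hlt =>
      absurd ⟨v, hv, p, hp, q, hq, hvp, hvq, hlt⟩ hne⟩

/-! ### Families of orders -/

/-- A family of interval orders on the edges of the complete graph on `U`, indexed by `I`, in which any
two edges sharing one endpoint are comparable in some member. -/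
structure IsSeparating {V ι : Type*} (U : Finset V) (I : Finset ι) (L R : ι → V → V → ℝ) :
    Prop where
  isLineOrder : ∀ i ∈ I, IsLineOrder U (L i) (R i)
  sep : ∀ v ∈ U, ∀ p ∈ U, ∀ q ∈ U, v ≠ p → v ≠ q → p ≠ q →
    ∃ i ∈ I, R i v p < L i v q ∨ R i v q < L i v p

namespace IsSeparating
variable {V ι : Type*} {U : Finset V} {I : Finset ι} {L R : ι → V → V → ℝ}

/-- If every comparable pair of the order `i` has an edge at `a`, then `i` is not needed after deleting
`a`. -/
theorem erase [DecidableEq V] [DecidableEq ι] (h : IsSeparating U I L R) {a : V} {i : ι}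
    (hi : ∀ v ∈ U, ∀ p ∈ U, ∀ q ∈ U, v ≠ p → v ≠ q → R i v p < L i v q →
      a = v ∨ a = p ∨ a = q) : IsSeparating (U.erase a) (I.erase i) L R where
  isLineOrder j hj := by
    have := h.isLineOrder j (Finset.mem_of_mem_erase hj)
    have hm : ∀ {x}, x ∈ U.erase a → x ∈ U := Finset.mem_of_mem_erase
    exact ⟨this.symmL, this.symmR, fun x hx y hy => this.le x (hm hx) y (hm hy),
      fun x hx y hy z hz w hw => this.meet x (hm hx) y (hm hy) z (hm hz) w (hm hw)⟩
  sep v hv p hp q hq hvp hvq hpq := by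
    rw [Finset.mem_erase] at hv hp hq
    obtain ⟨j, hj, hlt⟩ := h.sep v hv.2 p hp.2 q hq.2 hvp hvq hpq
    refine ⟨j, Finset.mem_erase.2 ⟨?_, hj⟩, hlt⟩
    rintro rfl
    rcases hlt with hlt | hlt
    · have := hi v hv.2 p hp.2 q hq.2 hvp hvq hlt
      grind
    · have := hi v hv.2 q hq.2 p hp.2 hvq hvp hlt
      grind

/-- The link of `v` is complete, and removing the `s` centres of stars leaves a complete graph on at
least `|U| - 1 - s` vertices whose edges are all among the single pairs. -/
theorem choose_two_le (h : IsSeparating U I L R) {F : ι → Patch V}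
    (hF : ∀ i ∈ I, (F i).Covers U (L i) (R i)) {v : V} (hv : v ∈ U) :
    (U.card - 1 - ∑ i ∈ I, (F i v).1.card).choose 2 ≤ ∑ i ∈ I, (F i v).2.card := by
  classical
  set T := I.biUnion fun i => (F i v).1
  set E := I.biUnion fun i => (F i v).2
  have hT : T.card ≤ ∑ i ∈ I, (F i v).1.card := Finset.card_biUnion_le
  have hE : E.card ≤ ∑ i ∈ I, (F i v).2.card := Finset.card_biUnion_le
  refine le_trans ?_ hE
  calc (U.card - 1 - ∑ i ∈ I, (F i v).1.card).choose 2
      ≤ ((U.erase v) \ T).card.choose 2 := by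
        apply Nat.choose_le_choose
        have := Finset.le_card_sdiff T (U.erase v)
        rw [Finset.card_erase_of_mem hv] at this
        omega
    _ = (((U.erase v) \ T).offDiag.image Sym2.mk.uncurry).card := by
        rw [← Sym2.card_image_offDiag]
    _ ≤ E.card := by
        apply Finset.card_le_card
        intro x hx
        simp only [Finset.mem_image, Finset.mem_offDiag, Finset.mem_sdiff, Finset.mem_erase,
          Prod.exists] at hx
        obtain ⟨p, q, ⟨⟨⟨hpv, hp⟩, hpT⟩, ⟨⟨hqv, hq⟩, hqT⟩, hpq⟩, rfl⟩ := hx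
        obtain ⟨i, hi, hlt⟩ := h.sep v hv p hp q hq hpv.symm hqv.symm hpq
        have hpT' : p ∉ (F i v).1 := fun hm => hpT (Finset.mem_biUnion.2 ⟨i, hi, hm⟩)
        have hqT' : q ∉ (F i v).1 := fun hm => hqT (Finset.mem_biUnion.2 ⟨i, hi, hm⟩)
        refine Finset.mem_biUnion.2 ⟨i, hi, ?_⟩
        rcases hlt with hlt | hlt
        · have := hF i hi v hv p hp q hq hpv.symm hqv.symm hpq hlt
          tauto
        · have := hF i hi v hv q hq p hp hqv.symm hpv.symm hpq.symm hlt
          rw [Sym2.eq_swap] at this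
          tauto

theorem three_le_card (h : IsSeparating U I L R) (hU : U.card = 5) : 3 ≤ I.card := by
  classical
  have hex : ∀ i, ∃ F : Patch V, i ∈ I → F.Covers U (L i) (R i) ∧
      ∑ v ∈ U, F.weight petersenWeight v ≤ 39 := by
    intro i
    by_cases hi : i ∈ I
    · obtain ⟨F, hF⟩ := (h.isLineOrder i hi).exists_petersenWeight_le
      exact ⟨F, fun _ => hF⟩
    · exact ⟨fun _ => (∅, ∅), fun hi' => absurd hi' hi⟩
  choose F hF using hex
  have h1 : ∀ v ∈ U, 16 ≤ ∑ i ∈ I, (F i).weight petersenWeight v := by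
    intro v hv
    have := h.choose_two_le (fun i hi => (hF i hi).1) hv
    rw [hU] at this
    exact (le_petersenWeight this).trans (petersenWeight_sum_le I _ _)
  have h2 := Finset.card_nsmul_le_sum U _ 16 h1
  rw [Finset.sum_comm] at h2
  have h3 := h2.trans (Finset.sum_le_card_nsmul I _ 39 fun i hi => (hF i hi).2)
  rw [hU] at h3
  simp only [smul_eq_mul] at h3
  omega

theorem card_mul_le (h : IsSeparating U I L R) (hs : ∀ i ∈ I, HasSmallPatch U (L i) (R i)) :
    U.card * (2 * U.card - 5) ≤ 13 * I.card := by
  classical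
  have hex : ∀ i, ∃ F : Patch V, i ∈ I → F.Covers U (L i) (R i) ∧
      ∑ v ∈ U, F.weight (fun s e => 2 * s + e) v ≤ 13 := by
    intro i
    by_cases hi : i ∈ I
    · obtain ⟨F, hF, hw⟩ := hs i hi
      refine ⟨F, fun _ => ⟨hF, (hw _ rfl fun s s' e e' _ _ => ?_).trans ?_⟩⟩
      · omega
      · simp [profileMax]
    · exact ⟨fun _ => (∅, ∅), fun hi' => absurd hi' hi⟩
  choose F hF using hex
  have h1 : ∀ v ∈ U, 2 * U.card - 5 ≤ ∑ i ∈ I, (F i).weight (fun s e => 2 * s + e) v := by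
    intro v hv
    have h1 := h.choose_two_le (fun i hi => (hF i hi).1) hv
    have h2 : ∀ x : ℕ, 2 * x ≤ x.choose 2 + 3 := by
      intro x
      rcases Nat.lt_or_ge x 4 with hx | hx
      · interval_cases x <;> simp [Nat.choose]
      · induction x, hx using Nat.le_induction with
        | base => simp [Nat.choose]
        | succ x hx ih =>
          have : (x + 1).choose 2 = x + x.choose 2 := by
            rw [Nat.choose_succ_succ', Nat.choose_one_right]
          omega
    have h3 := h2 (U.card - 1 - ∑ i ∈ I, (F i v).1.card)
    simp only [Patch.weight, Finset.sum_add_distrib, ← Finset.mul_sum]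
    omega
  have h2 := Finset.card_nsmul_le_sum U _ _ h1
  rw [Finset.sum_comm] at h2
  have h3 := h2.trans (Finset.sum_le_card_nsmul I _ 13 fun i hi => (hF i hi).2)
  simpa [mul_comm] using h3

theorem card_le (h : IsSeparating U I L R) (hU : 5 ≤ U.card) : U.card ≤ I.card + 2 := by
  classical
  obtain ⟨n, hn⟩ : ∃ n, U.card = n := ⟨_, rfl⟩
  rw [hn] at hU ⊢
  induction n, hU using Nat.le_induction generalizing U I with
  | base => have := h.three_le_card hn; omega
  | succ n hn5 ih =>
    by_cases hs : ∀ i ∈ I, HasSmallPatch U (L i) (R i)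
    · have h1 := h.card_mul_le hs
      by_contra! hlt
      rw [hn] at h1
      have h2 : I.card ≤ n - 2 := by omega
      obtain ⟨m, rfl⟩ := Nat.exists_eq_add_of_le hn5
      have h3 : 2 * (5 + m + 1) - 5 = 2 * m + 7 := by omega
      rw [h3] at h1
      nlinarith [show I.card ≤ m + 3 by omega]
    · push Not at hs
      obtain ⟨i, hi, hs⟩ := hs
      obtain ⟨a, ha, hstar⟩ := ((h.isLineOrder i hi).hasSmallPatch_or_star
        (Finset.card_pos.1 (by omega))).resolve_left hs
      have := ih (h.erase (a := a) (i := i) hstar) (by rw [Finset.card_erase_of_mem ha]; omega)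
      rw [Finset.card_erase_of_mem hi] at this
      have := Finset.card_pos.2 ⟨i, hi⟩
      omega

end IsSeparating

/-! ### Box representations -/

/-- Two boxes meet if and only if in each coordinate neither interval lies to the left of the other. -/
theorem hasBoxRepresentation_iff {V : Type*} {G : SimpleGraph V} {d : ℕ} :
    HasBoxRepresentation G d ↔ ∃ lo hi : V → Fin d → ℝ, (∀ v, lo v ≤ hi v) ∧
      ∀ u v, u ≠ v → (G.Adj u v ↔ lo u ≤ hi v ∧ lo v ≤ hi u) := by
  have key : ∀ a b a' b' : Fin d → ℝ, a ≤ b → a' ≤ b' →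
      ((Set.univ.pi (fun i => Set.Icc (a i) (b i)) ∩
        Set.univ.pi (fun i => Set.Icc (a' i) (b' i))).Nonempty ↔ a ≤ b' ∧ a' ≤ b) := by
    intro a b a' b' h h'
    rw [Set.pi_univ_Icc, Set.pi_univ_Icc, Set.Icc_inter_Icc, Set.nonempty_Icc, sup_le_iff,
      le_inf_iff, le_inf_iff]
    tauto
  constructor
  · rintro ⟨B, hB, rfl⟩
    choose lo hi hle hB using hB
    refine ⟨lo, hi, hle, fun u v huv => ?_⟩
    rw [← key _ _ _ _ (hle u) (hle v), ← hB, ← hB]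
    simp [intersectionGraph, huv]
  · rintro ⟨lo, hi, hle, h⟩
    refine ⟨fun v => Set.univ.pi fun i => Set.Icc (lo v i) (hi v i),
      fun v => ⟨lo v, hi v, hle v, rfl⟩, ?_⟩
    ext u v
    by_cases huv : u = v
    · subst huv; simp
    · rw [h u v huv, ← key _ _ _ _ (hle u) (hle v)]
      simp [intersectionGraph, huv]

theorem le_of_hasBoxRepresentation {n d : ℕ} (hn : 5 ≤ n)
    (h : HasBoxRepresentation (kneserGraph n 2) d) : n ≤ d + 2 := by
  obtain ⟨lo, hi, hle, hadj⟩ := hasBoxRepresentation_iff.1 h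
  let L : Fin d → Fin n → Fin n → ℝ := fun i x y =>
    if h : x ≠ y then lo ⟨{x, y}, Finset.card_pair h⟩ i else 0
  let R : Fin d → Fin n → Fin n → ℝ := fun i x y =>
    if h : x ≠ y then hi ⟨{x, y}, Finset.card_pair h⟩ i else 0
  have hsep : IsSeparating (Finset.univ : Finset (Fin n)) (Finset.univ : Finset (Fin d)) L R := by
    refine ⟨fun i _ => ⟨?_, ?_, ?_, ?_⟩, ?_⟩
    · intro x y
      simp only [L, Finset.pair_comm x y, ne_comm (a := x)]
    · intro x y
      simp only [R, Finset.pair_comm x y, ne_comm (a := x)]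
    · intro x _ y _ hxy
      simp only [L, R, dif_pos hxy]
      exact hle _ i
    · intro x _ y _ z _ w _ hxy hzw hlt
      simp only [L, R, dif_pos hxy, dif_pos hzw] at hlt
      by_contra! hne
      have hdisj : Disjoint ({x, y} : Finset (Fin n)) {z, w} := by
        simp [Finset.disjoint_left, hne]
      have hne' : (⟨{x, y}, Finset.card_pair hxy⟩ : {s : Finset (Fin n) // s.card = 2}) ≠
          ⟨{z, w}, Finset.card_pair hzw⟩ := by
        intro heq
        have h1 : x ∈ ({z, w} : Finset (Fin n)) :=
          (Finset.ext_iff.1 (congrArg Subtype.val heq) x).1 (Finset.mem_insert_self x {y})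
        simp [hne] at h1
      exact absurd (((hadj _ _ hne').1 ⟨hne', hdisj⟩).2 i) (not_le.2 hlt)
    · intro v _ p _ q _ hvp hvq hpq
      have hne' : (⟨{v, p}, Finset.card_pair hvp⟩ : {s : Finset (Fin n) // s.card = 2}) ≠
          ⟨{v, q}, Finset.card_pair hvq⟩ := by
        intro heq
        have h1 : p ∈ ({v, q} : Finset (Fin n)) :=
          (Finset.ext_iff.1 (congrArg Subtype.val heq) p).1
            (Finset.mem_insert_of_mem (Finset.mem_singleton_self p))
        simp [hvp.symm, hpq] at h1
      have hnadj : ¬ (kneserGraph n 2).Adj ⟨{v, p}, Finset.card_pair hvp⟩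
          ⟨{v, q}, Finset.card_pair hvq⟩ := by
        rintro ⟨-, hd⟩
        simp at hd
      rw [hadj _ _ hne', not_and_or, Pi.le_def, Pi.le_def, not_forall, not_forall] at hnadj
      simp only [L, R, dif_pos hvp, dif_pos hvq, Finset.mem_univ, true_and]
      rcases hnadj with ⟨i, hi⟩ | ⟨i, hi⟩
      · exact ⟨i, .inr (not_le.1 hi)⟩
      · exact ⟨i, .inl (not_le.1 hi)⟩
  simpa using hsep.card_le (by simpa using hn)

/-! ### A representation in `n - 2` dimensions -/

/-- Left end of the edge `e` in the coordinate with centre `a = i + 1`. An edge `{a, x}` becomes the point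
`x`, which is the sum of the elements of `e` minus `a`. -/
def kneserLo (n : ℕ) (e : Finset (Fin n)) (i : Fin (n - 2)) : ℕ :=
  if (⟨i.1 + 1, by have := i.2; omega⟩ : Fin n) ∈ e then ∑ x ∈ e, (x : ℕ) - (i + 1)
  else if (⟨0, by have := i.2; omega⟩ : Fin n) ∈ e then 1 else 0

/-- Right end of the edge `e` in the coordinate with centre `i + 1`, see `kneserLo`. -/
def kneserHi (n : ℕ) (e : Finset (Fin n)) (i : Fin (n - 2)) : ℕ :=
  if (⟨i.1 + 1, by have := i.2; omega⟩ : Fin n) ∈ e then ∑ x ∈ e, (x : ℕ) - (i + 1)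
  else if (⟨n - 1, by have := i.2; omega⟩ : Fin n) ∈ e then n - 2 else n - 1

theorem kneserLo_pair {n : ℕ} {p q : Fin n} (hpq : p ≠ q) (i : Fin (n - 2)) :
    kneserLo n {p, q} i = if (p : ℕ) = i + 1 then (q : ℕ) else if (q : ℕ) = i + 1 then (p : ℕ)
      else if (p : ℕ) = 0 ∨ (q : ℕ) = 0 then 1 else 0 := by
  simp only [kneserLo, Finset.sum_pair hpq, Finset.mem_insert, Finset.mem_singleton, Fin.ext_iff]
  have : (p : ℕ) ≠ q := fun h => hpq (Fin.ext h)
  split_ifs <;> omega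

theorem kneserHi_pair {n : ℕ} {p q : Fin n} (hpq : p ≠ q) (i : Fin (n - 2)) :
    kneserHi n {p, q} i = if (p : ℕ) = i + 1 then (q : ℕ) else if (q : ℕ) = i + 1 then (p : ℕ)
      else if (p : ℕ) = n - 1 ∨ (q : ℕ) = n - 1 then n - 2 else n - 1 := by
  simp only [kneserHi, Finset.sum_pair hpq, Finset.mem_insert, Finset.mem_singleton, Fin.ext_iff]
  have : (p : ℕ) ≠ q := fun h => hpq (Fin.ext h)
  split_ifs <;> omega

theorem kneserLo_le_kneserHi {n : ℕ} {e f : Finset (Fin n)} (he : e.card = 2) (hf : f.card = 2)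
    (h : e = f ∨ Disjoint e f) (i : Fin (n - 2)) : kneserLo n e i ≤ kneserHi n f i := by
  obtain ⟨p, q, hpq, rfl⟩ := Finset.card_eq_two.1 he
  obtain ⟨r, s, hrs, rfl⟩ := Finset.card_eq_two.1 hf
  have hi := i.2
  have := p.2; have := q.2; have := r.2; have := s.2
  rcases h with h | h
  · rw [← h, kneserLo_pair hpq, kneserHi_pair hpq]
    split_ifs <;> omega
  · rw [kneserLo_pair hpq, kneserHi_pair hrs]
    simp only [Finset.disjoint_insert_left, Finset.disjoint_singleton_left, Finset.mem_insert,
      Finset.mem_singleton, Fin.ext_iff] at h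
    split_ifs <;> omega

theorem exists_kneserHi_lt_kneserLo {n : ℕ} {p q r : Fin n} (hpq : p ≠ q) (hpr : p ≠ r)
    (hqr : q ≠ r) : ∃ i, kneserHi n {p, q} i < kneserLo n {p, r} i ∨
      kneserHi n {p, r} i < kneserLo n {p, q} i := by
  have := p.2; have := q.2; have := r.2
  have hqr' : (q : ℕ) ≠ r := fun h => hqr (Fin.ext h)
  have hpq' : (p : ℕ) ≠ q := fun h => hpq (Fin.ext h)
  have hpr' : (p : ℕ) ≠ r := fun h => hpr (Fin.ext h)
  -- The coordinate: one whose centre is `p` if possible, otherwise `q` or `r`.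
  have key : ∃ x : Fin n, 0 < (x : ℕ) ∧ (x : ℕ) < n - 1 ∧
      (x = p ∨ (((p : ℕ) = 0 ∨ (p : ℕ) = n - 1) ∧ (x = q ∨ x = r))) := by
    by_cases h1 : 0 < (p : ℕ) ∧ (p : ℕ) < n - 1
    · exact ⟨p, h1.1, h1.2, .inl rfl⟩
    by_cases h2 : 0 < (q : ℕ) ∧ (q : ℕ) < n - 1
    · exact ⟨q, h2.1, h2.2, .inr ⟨by omega, .inl rfl⟩⟩
    · exact ⟨r, by omega, by omega, .inr ⟨by omega, .inr rfl⟩⟩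
  obtain ⟨x, hx0, hxn, hx⟩ := key
  refine ⟨⟨x - 1, by omega⟩, ?_⟩
  rw [kneserLo_pair hpq, kneserLo_pair hpr, kneserHi_pair hpq, kneserHi_pair hpr]
  simp only [Nat.sub_add_cancel (Nat.succ_le_of_lt hx0)]
  rcases hx with rfl | ⟨hp, rfl | rfl⟩
  · simp only [if_true]; omega
  · rw [if_neg hpq', if_pos rfl]
    split_ifs <;> omega
  · rw [if_neg hpr', if_pos rfl]
    split_ifs <;> omega

theorem hasBoxRepresentation_kneserGraph (n : ℕ) :
    HasBoxRepresentation (kneserGraph n 2) (n - 2) := by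
  refine hasBoxRepresentation_iff.2 ⟨fun e i => kneserLo n e.1 i, fun e i => kneserHi n e.1 i,
    fun e i => Nat.cast_le.2 (kneserLo_le_kneserHi e.2 e.2 (.inl rfl) i), fun e f hef => ⟨?_, ?_⟩⟩
  · rintro ⟨-, h⟩
    exact ⟨fun i => Nat.cast_le.2 (kneserLo_le_kneserHi e.2 f.2 (.inr h) i),
      fun i => Nat.cast_le.2 (kneserLo_le_kneserHi f.2 e.2 (.inr h.symm) i)⟩
  · rintro ⟨h₁, h₂⟩
    refine ⟨hef, Finset.disjoint_left.2 fun p hpe hpf => ?_⟩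
    obtain ⟨e, he⟩ := e
    obtain ⟨f, hf⟩ := f
    have key : ∀ g : Finset (Fin n), g.card = 2 → p ∈ g → ∃ q, p ≠ q ∧ g = {p, q} := by
      intro g hg hp
      obtain ⟨x, y, hxy, rfl⟩ := Finset.card_eq_two.1 hg
      rcases Finset.mem_insert.1 hp with rfl | hp
      · exact ⟨y, hxy, rfl⟩
      · rw [Finset.mem_singleton] at hp
        subst hp
        exact ⟨x, hxy.symm, Finset.pair_comm _ _⟩
    obtain ⟨q, hpq, rfl⟩ := key e he hpe
    obtain ⟨r, hpr, rfl⟩ := key f hf hpf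
    have hqr : q ≠ r := by
      rintro rfl
      exact hef rfl
    obtain ⟨i, hi | hi⟩ := exists_kneserHi_lt_kneserLo hpq hpr hqr
    · exact absurd (Nat.cast_le.1 (h₂ i)) (not_le.2 hi)
    · exact absurd (Nat.cast_le.1 (h₁ i)) (not_le.2 hi)

theorem theorem1 :
    (∀ n : ℕ, 5 ≤ n → boxicity (kneserGraph n 2) = ((n - 2 : ℕ) : ℕ∞)) ∧
      boxicity (kneserGraph 5 2) = 3 := by
  have main : ∀ n : ℕ, 5 ≤ n → boxicity (kneserGraph n 2) = ((n - 2 : ℕ) : ℕ∞) := by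
    intro n hn
    refine le_antisymm (iInf₂_le (n - 2) (hasBoxRepresentation_kneserGraph n))
      (le_iInf₂ fun d hd => ?_)
    have := le_of_hasBoxRepresentation hn hd
    exact_mod_cast (by omega : n - 2 ≤ d)
  exact ⟨main, by simpa using main 5 le_rfl⟩
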